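/- **Setting and definitions.** A metric space $(X,\rho)$ is uniquely geodesic if for all $p,q\in X$ there is exactly one geodesic $\gamma_{p,q}$ from $p$ to $q$, that is, an isometric map $\gamma_{p,q}:[0,\rho(p,q)]\to X$ with $\gamma_{p,q}(0)=p$ and $\gamma_{p,q}(\rho(p,q))=q$; then $(1-\alpha)p\oplus\alpha q=\gamma_{p,q}(\alpha\rho(p,q))$ for $\alpha\in[0,1]$. It is a $\mathrm{CAT}(0)$ space if, moreover, $$\rho\bigl((1-\alpha)x\oplus\alpha y,\,(1-\beta)x\oplus\beta z\bigr)\le\bigl|(1-\alpha)\bar x+\alpha\bar y-((1-\beta)\bar x+\beta\bar z)\bigr|$$ whenever $\alpha,\beta\in[0,1]$, $x,y,z\in X$, and $\bar x,\bar y,\bar z\in\mathbb R^2$ satisfy $\rho(x,y)=|\bar x-\bar y|$, $\rho(y,z)=|\bar y-\bar z|$, $\rho(z,x)=|\bar z-\bar x|$. An Hadamard space is a complete $\mathrm{CAT}(0)$ space. Let $X$ be a $\mathrm{CAT}(0)$ space and $p\in X$. Let $\Gamma_p$ be the set of geodesics from $p$, and $L_\gamma$ the length of $\gamma\in\Gamma_p$.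 For $x,y\ne p$ the comparison angle is $\overline\angle_p(x,y)=\arccos\frac{\rho(p,x)^2+\rho(p,y)^2-\rho(x,y)^2}{2\rho(p,x)\rho(p,y)}$. The Alexandrov angle of $\gamma,\eta\in\Gamma_p$ is $\angle_p(\gamma,\eta)=\lim_{s,t\to+0}\overline\angle_p(\gamma(s),\eta(t))$ if $L_\gamma,L_\eta>0$; it is $0$ if $L_\gamma=L_\eta=0$, and $\pi/2$ if exactly one of the two lengths is $0$. On $[0,\infty)\times\Gamma_p$, $$\tilde d_p\bigl((\alpha,\gamma),(\beta,\eta)\bigr)=\sqrt{(\alpha L_\gamma)^2+(\beta L_\eta)^2-2(\alpha L_\gamma)(\beta L_\eta)\cos\angle_p(\gamma,\eta)}$$ is a pseudometric. The tangent space $(T_pX,d_p)$ is the metric space obtained by identifying pairs at distance $0$; the class of $(\alpha,\gamma)$ is written $\alpha\gamma$, with $\gamma=1\gamma$, and $0_p=0\gamma_{p,p}$. For $u,v\in T_pX$ put $g_p(u,v)=\tfrac12\bigl(d_p(u,0_p)^2+d_p(v,0_p)^2-d_p(u,v)^2\bigr)$. A vector field on $X$ is a map $A$ assigning to each $x\in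 X$ a (possibly empty) set $Ax\subset T_xX$. It is monotone if $g_x(x^*,\gamma_{x,y})+g_y(y^*,\gamma_{y,x})\le 0$ for all $x,y\in X$, $x^*\in Ax$, $y^*\in Ay$. A monotone vector field satisfies the surjectivity condition if for all $\lambda>0$ and $x\in X$ there is $z\in X$ with $\frac1\lambda\gamma_{z,x}\in Az$; such a $z$ is then unique and is denoted by $J_\lambda x$ (the resolvent). Let $\mathrm{Zer}(A)=\{u\in X:0_u\in Au\}$. A sequence $\{x_n\}$ in $X$ is $\Delta$-convergent to $p\in X$ if for every subsequence $\{x_{n_i}\}$ the point $p$ is the only $z\in X$ such that $\limsup_i\rho(z,x_{n_i})\le\limsup_i\rho(y,x_{n_i})$ for all $y\in X$ (upper limits in $[0,\infty]$). **Theorem.** Let $X$ be an Hadamard space, $A$ a monotone vector field on $X$ satisfying the surjectivity condition, $\{\lambda_n\}_{n\ge1}$ a sequence of positive real numbers, and $\{x_n\}_{n\ge1}$ a sequence with $x_1\in X$ and $x_{n+1}=J_{\lambda_n}x_n$ for $n=1,2,\dots$. Then the following hold. (i) If $\sum_{n=1}^\infty\lambda_n=\infty$, then $\{x_n\}$ is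 bounded if and only if $\mathrm{Zer}(A)$ is nonempty. (ii) If $\mathrm{Zer}(A)$ is nonempty and $\sum_{n=1}^\infty\lambda_n^2=\infty$, then $\{x_n\}$ is $\Delta$-convergent to a point of $\mathrm{Zer}(A)$. -/

import Mathlib

open Set Filter Topology
open scoped NNReal ENNReal

noncomputable section

namespace CAT0

universe u

variable {X : Type u} [MetricSpace X]

/-- A geodesic from `p`: a map `path : [0, len] → X` with `path 0 = p` and
`dist (path s) (path t) = |s - t|`.  The type `Geodesic p` is the set `Γ_p`. -/
structure Geodesic (p : X) where
  len : ℝ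
  len_nonneg : 0 ≤ len
  path : Icc (0 : ℝ) len → X
  path_zero : path ⟨0, le_rfl, len_nonneg⟩ = p
  dist_path : ∀ s t : Icc (0 : ℝ) len, dist (path s) (path t) = |(s : ℝ) - (t : ℝ)|

/-- The point `γ(t)`, for `t ∈ [0, len]` (real parameters outside are clamped to the interval). -/
def Geodesic.eval {p : X} (γ : Geodesic p) (t : ℝ) : X :=
  γ.path (projIcc 0 γ.len γ.len_nonneg t)

/-- The point `q` for which `γ` is a geodesic from `p` to `q`. -/
def Geodesic.endpoint {p : X} (γ : Geodesic p) : X :=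
  γ.path ⟨γ.len, γ.len_nonneg, le_rfl⟩

/-- Any two points are joined by exactly one geodesic. -/
class UniquelyGeodesic (X : Type u) [MetricSpace X] : Prop where
  existsUnique_geodesic : ∀ p q : X, ∃! γ : Geodesic p, γ.endpoint = q

/-- The geodesic `γ_{p,q}` from `p` to `q`. -/
def geod [UniquelyGeodesic X] (p q : X) : Geodesic p :=
  (UniquelyGeodesic.existsUnique_geodesic p q).choose

/-- The convex combination `(1 - α) p ⊕ α q`. -/
def comb [UniquelyGeodesic X] (p q : X) (α : ℝ) : X :=
  (geod p q).eval (α * dist p q)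

/-- `CAT(0)` spaces: uniquely geodesic metric spaces whose triangles are no thicker than
their comparison triangles in the Euclidean plane. -/
class CAT0Space (X : Type u) [MetricSpace X] : Prop extends UniquelyGeodesic X where
  comparison : ∀ (x y z : X) (x' y' z' : EuclideanSpace ℝ (Fin 2)),
    dist x y = dist x' y' → dist y z = dist y' z' → dist z x = dist z' x' →
    ∀ α ∈ Icc (0 : ℝ) 1, ∀ β ∈ Icc (0 : ℝ) 1,
      dist (comb x y α) (comb x z β) ≤
        dist ((1 - α) • x' + α • y') ((1 - β) • x' + β • z')

open Classical in
/-- The comparison angle at `p` between `x` and `y`: the angle at `p'` of a triangle `p' x' y'`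
in the Euclidean plane with the same side lengths, given by the law of cosines
(see `comparisonAngle_eq_angle`). -/
def comparisonAngle (p x y : X) : ℝ :=
  if p ≠ x ∧ p ≠ y then
    Real.arccos ((dist p x ^ 2 + dist p y ^ 2 - dist x y ^ 2) / (2 * dist p x * dist p y))
  else if p = x ∧ p = y then 0
  else Real.pi / 2

open Classical in
/-- The Alexandrov angle at `p` between two geodesics from `p`.  In a `CAT(0)` space the limit
exists (see `tendsto_comparisonAngle`). -/
def alexandrovAngle {p : X} (γ η : Geodesic p) : ℝ :=
  if p ≠ γ.endpoint ∧ p ≠ η.endpoint then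
    limUnder (𝓝[>] (0 : ℝ) ×ˢ 𝓝[>] (0 : ℝ))
      (fun st => comparisonAngle p (γ.eval st.1) (η.eval st.2))
  else if p = γ.endpoint ∧ p = η.endpoint then 0
  else Real.pi / 2

/-- The set `Y = [0, ∞) × Γ_p`. -/
structure PreTangent (p : X) where
  coeff : ℝ≥0
  geodesic : Geodesic p

/-- The length `α L_γ` of a pair `(α, γ)`. -/
def PreTangent.length {p : X} (a : PreTangent p) : ℝ := a.coeff * a.geodesic.len

/-- The pseudometric on `Y = [0, ∞) × Γ_p`, given by the law of cosines. -/
def preDist {p : X} (a b : PreTangent p) : ℝ :=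
  Real.sqrt (a.length ^ 2 + b.length ^ 2 -
    2 * a.length * b.length * Real.cos (alexandrovAngle a.geodesic b.geodesic))

/-! ### The facts that make the definitions meaningful -/

theorem Geodesic.dist_eval {p : X} (γ : Geodesic p) {s t : ℝ} (hs : s ∈ Icc 0 γ.len)
    (ht : t ∈ Icc 0 γ.len) : dist (γ.eval s) (γ.eval t) = |s - t| := by
  rw [eval, eval, projIcc_of_mem _ hs, projIcc_of_mem _ ht, γ.dist_path]

theorem Geodesic.eval_zero {p : X} (γ : Geodesic p) : γ.eval 0 = p := by
  rw [eval, projIcc_of_mem _ ⟨le_rfl, γ.len_nonneg⟩, γ.path_zero]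

theorem Geodesic.eval_len {p : X} (γ : Geodesic p) : γ.eval γ.len = γ.endpoint := by
  rw [eval, projIcc_of_mem _ ⟨γ.len_nonneg, le_rfl⟩, endpoint]

theorem Geodesic.dist_start_eval {p : X} (γ : Geodesic p) {t : ℝ} (ht : t ∈ Icc 0 γ.len) :
    dist p (γ.eval t) = t := by
  have h := γ.dist_eval ⟨le_rfl, γ.len_nonneg⟩ ht
  rw [γ.eval_zero, zero_sub, abs_neg, abs_of_nonneg ht.1] at h
  exact h

theorem Geodesic.dist_endpoint {p : X} (γ : Geodesic p) : dist p γ.endpoint = γ.len := by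
  rw [← γ.eval_len]; exact γ.dist_start_eval ⟨γ.len_nonneg, le_rfl⟩

theorem geod_endpoint [UniquelyGeodesic X] (p q : X) : (geod p q).endpoint = q :=
  (UniquelyGeodesic.existsUnique_geodesic p q).choose_spec.1

theorem Geodesic.eq_geod [UniquelyGeodesic X] {p q : X} (γ : Geodesic p) (h : γ.endpoint = q) :
    γ = geod p q :=
  (UniquelyGeodesic.existsUnique_geodesic p q).choose_spec.2 γ h

/-- The restriction of a geodesic to `[0, l]`. -/
def Geodesic.restrict {p : X} (γ : Geodesic p) (l : ℝ) (hl : l ∈ Icc 0 γ.len) : Geodesic p where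
  len := l
  len_nonneg := hl.1
  path := fun t => γ.eval t
  path_zero := γ.eval_zero
  dist_path := fun s t =>
    γ.dist_eval ⟨s.2.1, s.2.2.trans hl.2⟩ ⟨t.2.1, t.2.2.trans hl.2⟩

theorem Geodesic.comb_eval [UniquelyGeodesic X] {p : X} (γ : Geodesic p) {l α : ℝ}
    (hl : l ∈ Icc 0 γ.len) (hα : α ∈ Icc (0 : ℝ) 1) :
    comb p (γ.eval l) α = γ.eval (α * l) := by
  have h : γ.restrict l hl = geod p (γ.eval l) := Geodesic.eq_geod _ rfl
  have hmem : α * l ∈ Icc (0 : ℝ) l :=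
    ⟨mul_nonneg hα.1 hl.1, mul_le_of_le_one_left hl.1 hα.2⟩
  rw [comb, γ.dist_start_eval hl, ← h, Geodesic.eval, projIcc_of_mem (γ.restrict l hl).len_nonneg hmem]
  rfl

/-- For genuine triangles the comparison angle is the angle of any Euclidean comparison triangle. -/
theorem comparisonAngle_eq_angle {p x y : X} (hx : p ≠ x) (hy : p ≠ y)
    {p' x' y' : EuclideanSpace ℝ (Fin 2)} (h₁ : dist p x = dist p' x')
    (h₂ : dist x y = dist x' y') (h₃ : dist y p = dist y' p') :
    comparisonAngle p x y = EuclideanGeometry.angle x' p' y' := by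
  have h := EuclideanGeometry.law_cos x' p' y'
  have hx0 : 0 < dist p x := dist_pos.2 hx
  have hy0 : 0 < dist y p := dist_pos.2 (Ne.symm hy)
  rw [dist_comm x' p', ← h₁, ← h₂, ← h₃] at h
  rw [comparisonAngle, if_pos ⟨hx, hy⟩, dist_comm p y]
  have : (dist p x ^ 2 + dist y p ^ 2 - dist x y ^ 2) / (2 * dist p x * dist y p) =
      Real.cos (EuclideanGeometry.angle x' p' y') := by
    rw [div_eq_iff (by positivity)]; linarith
  rw [this, Real.arccos_cos (EuclideanGeometry.angle_nonneg _ _ _)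
    (EuclideanGeometry.angle_le_pi _ _ _)]

theorem exists_comparison_triangle (p x y : X) : ∃ x' y' : EuclideanSpace ℝ (Fin 2),
    dist p x = dist 0 x' ∧ dist x y = dist x' y' ∧ dist y p = dist y' 0 := by
  have t1 := dist_triangle p x y
  have t2 := dist_triangle x p y
  have t3 := dist_triangle_right p x y
  rw [dist_comm x p] at t2
  rw [dist_comm y p]
  set a := dist p x
  set b := dist x y
  set c := dist p y
  have ha : 0 ≤ a := dist_nonneg
  have hb : 0 ≤ b := dist_nonneg
  have hc : 0 ≤ c := dist_nonneg
  have hE : ∀ r s r' s' d : ℝ, 0 ≤ d → (r - r') ^ 2 + (s - s') ^ 2 = d ^ 2 →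
      d = dist (!₂[r, s] : EuclideanSpace ℝ (Fin 2)) !₂[r', s'] := by
    intro r s r' s' d hd h
    simp [EuclideanSpace.dist_eq, Real.dist_eq, h, Real.sqrt_sq hd]
  have h00 : (0 : EuclideanSpace ℝ (Fin 2)) = !₂[0, 0] := by
    ext i; fin_cases i <;> simp
  rw [h00]
  rcases ha.eq_or_lt with h0 | h0
  · have hbc : b = c := by linarith
    refine ⟨!₂[0, 0], !₂[c, 0], hE _ _ _ _ _ ha ?_, hE _ _ _ _ _ hb ?_, hE _ _ _ _ _ hc ?_⟩
    · rw [← h0]; ring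
    · rw [hbc]; ring
    · ring
  · set v := (a ^ 2 + c ^ 2 - b ^ 2) / (2 * a) with hv
    have hva : 2 * a * v = a ^ 2 + c ^ 2 - b ^ 2 := by rw [hv]; field_simp
    have hvc : v ^ 2 ≤ c ^ 2 := by
      apply sq_le_sq'
      · nlinarith
      · nlinarith
    have hw := Real.sq_sqrt (sub_nonneg.2 hvc)
    refine ⟨!₂[a, 0], !₂[v, Real.sqrt (c ^ 2 - v ^ 2)], hE _ _ _ _ _ ha ?_, hE _ _ _ _ _ hb ?_,
      hE _ _ _ _ _ hc ?_⟩
    · ring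
    · linear_combination hw - hva
    · linear_combination hw

/-- The cosine of the comparison angle between `γ(s)` and `η(t)`. -/
def cosComparison {p : X} (γ η : Geodesic p) (s t : ℝ) : ℝ :=
  (s ^ 2 + t ^ 2 - dist (γ.eval s) (η.eval t) ^ 2) / (2 * s * t)

theorem cosComparison_mul {p : X} (γ η : Geodesic p) {s t : ℝ} (hs : 0 < s) (ht : 0 < t) :
    dist (γ.eval s) (η.eval t) ^ 2 = s ^ 2 + t ^ 2 - 2 * s * t * cosComparison γ η s t := by
  rw [cosComparison]; field_simp; ring

theorem cosComparison_le_one {p : X} (γ η : Geodesic p) {s t : ℝ} (hs : s ∈ Ioc 0 γ.len)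
    (ht : t ∈ Ioc 0 η.len) : cosComparison γ η s t ≤ 1 := by
  have h1 := hs.1
  have h2 := ht.1
  rw [cosComparison, div_le_one (by positivity)]
  have t2 := dist_triangle p (γ.eval s) (η.eval t)
  have t1 := dist_triangle_right p (γ.eval s) (η.eval t)
  rw [γ.dist_start_eval (Ioc_subset_Icc_self hs), η.dist_start_eval (Ioc_subset_Icc_self ht)] at *
  have h : (s - t) ^ 2 ≤ dist (γ.eval s) (η.eval t) ^ 2 :=
    sq_le_sq' (by linarith) (by linarith)
  linarith

theorem neg_one_le_cosComparison {p : X} (γ η : Geodesic p) {s t : ℝ} (hs : s ∈ Ioc 0 γ.len)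
    (ht : t ∈ Ioc 0 η.len) : -1 ≤ cosComparison γ η s t := by
  have h1 := hs.1
  have h2 := ht.1
  rw [cosComparison, le_div_iff₀ (by positivity)]
  have t2 := dist_triangle_left (γ.eval s) (η.eval t) p
  rw [γ.dist_start_eval (Ioc_subset_Icc_self hs), η.dist_start_eval (Ioc_subset_Icc_self ht)] at t2
  nlinarith [dist_nonneg (x := γ.eval s) (y := η.eval t)]

theorem comparisonAngle_eval {p : X} (γ η : Geodesic p) {s t : ℝ} (hs : s ∈ Ioc 0 γ.len)
    (ht : t ∈ Ioc 0 η.len) :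
    comparisonAngle p (γ.eval s) (η.eval t) = Real.arccos (cosComparison γ η s t) := by
  have h1 := γ.dist_start_eval (Ioc_subset_Icc_self hs)
  have h2 := η.dist_start_eval (Ioc_subset_Icc_self ht)
  rw [comparisonAngle, if_pos, h1, h2, cosComparison]
  exact ⟨dist_pos.1 (h1.symm ▸ hs.1 : 0 < dist p (γ.eval s)),
    dist_pos.1 (h2.symm ▸ ht.1 : 0 < dist p (η.eval t))⟩

/-- In a `CAT(0)` space comparison angles decrease when the parameters decrease. -/
theorem cosComparison_anti [CAT0Space X] {p : X} (γ η : Geodesic p) {s₁ s₂ t₁ t₂ : ℝ}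
    (hs₁ : 0 < s₁) (hs : s₁ ≤ s₂) (hs₂ : s₂ ≤ γ.len) (ht₁ : 0 < t₁) (ht : t₁ ≤ t₂)
    (ht₂ : t₂ ≤ η.len) : cosComparison γ η s₂ t₂ ≤ cosComparison γ η s₁ t₁ := by
  have hs2 : 0 < s₂ := hs₁.trans_le hs
  have ht2 : 0 < t₂ := ht₁.trans_le ht
  obtain ⟨x', y', h1, h2, h3⟩ := exists_comparison_triangle p (γ.eval s₂) (η.eval t₂)
  have hα : s₁ / s₂ ∈ Icc (0 : ℝ) 1 := ⟨by positivity, (div_le_one hs2).2 hs⟩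
  have hβ : t₁ / t₂ ∈ Icc (0 : ℝ) 1 := ⟨by positivity, (div_le_one ht2).2 ht⟩
  have h := CAT0Space.comparison p (γ.eval s₂) (η.eval t₂) 0 x' y' h1 h2 h3 _ hα _ hβ
  rw [γ.comb_eval ⟨hs2.le, hs₂⟩ hα, η.comb_eval ⟨ht2.le, ht₂⟩ hβ, div_mul_cancel₀ _ hs2.ne',
    div_mul_cancel₀ _ ht2.ne', smul_zero, smul_zero, zero_add, zero_add] at h
  rw [γ.dist_start_eval ⟨hs2.le, hs₂⟩, dist_zero_left] at h1
  rw [dist_comm, η.dist_start_eval ⟨ht2.le, ht₂⟩, dist_zero_right] at h3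
  have hsq := pow_le_pow_left₀ dist_nonneg h 2
  rw [cosComparison_mul γ η hs₁ ht₁, dist_eq_norm, norm_sub_sq_real, norm_smul, norm_smul,
    inner_smul_left, inner_smul_right, ← h1, ← h3, Real.norm_of_nonneg hα.1,
    Real.norm_of_nonneg hβ.1, div_mul_cancel₀ _ hs2.ne', div_mul_cancel₀ _ ht2.ne'] at hsq
  have hi := cosComparison_mul γ η hs2 ht2
  rw [h2, dist_eq_norm, norm_sub_sq_real, ← h1, ← h3] at hi
  have hi' : inner ℝ x' y' = s₂ * t₂ * cosComparison γ η s₂ t₂ := by linarith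
  rw [hi'] at hsq
  have e : s₁ / s₂ * (t₁ / t₂ * (s₂ * t₂ * cosComparison γ η s₂ t₂)) =
      s₁ * t₁ * cosComparison γ η s₂ t₂ := by field_simp
  simp only [conj_trivial] at hsq
  rw [e] at hsq
  have hpos : 0 < s₁ * t₁ := by positivity
  nlinarith

theorem exists_tendsto_cosComparison [CAT0Space X] {p : X} (γ η : Geodesic p) (hγ : 0 < γ.len)
    (hη : 0 < η.len) : ∃ c ∈ Icc (-1 : ℝ) 1,
      Tendsto (fun st : ℝ × ℝ => cosComparison γ η st.1 st.2) (𝓝[>] 0 ×ˢ 𝓝[>] 0) (𝓝 c) := by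
  set S : Set ℝ := (fun st : ℝ × ℝ => cosComparison γ η st.1 st.2) ''
    (Ioc 0 γ.len ×ˢ Ioc 0 η.len)
  have hb : ∀ c ∈ S, c ≤ 1 := by
    rintro _ ⟨⟨s, t⟩, ⟨hs, ht⟩, rfl⟩
    exact cosComparison_le_one γ η hs ht
  have hm : cosComparison γ η γ.len η.len ∈ S :=
    ⟨(γ.len, η.len), ⟨⟨hγ, le_rfl⟩, ⟨hη, le_rfl⟩⟩, rfl⟩
  have hbdd : BddAbove S := ⟨1, hb⟩
  refine ⟨sSup S, ⟨?_, csSup_le ⟨_, hm⟩ hb⟩, ?_⟩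
  · exact (neg_one_le_cosComparison γ η ⟨hγ, le_rfl⟩ ⟨hη, le_rfl⟩).trans (le_csSup hbdd hm)
  · rw [tendsto_order]
    constructor
    · intro a ha
      obtain ⟨_, ⟨⟨s, t⟩, ⟨hs, ht⟩, rfl⟩, hc⟩ := exists_lt_of_lt_csSup ⟨_, hm⟩ ha
      filter_upwards [prod_mem_prod (Ioc_mem_nhdsGT hs.1) (Ioc_mem_nhdsGT ht.1)]
      rintro ⟨s', t'⟩ ⟨hs', ht'⟩
      exact hc.trans_le (cosComparison_anti γ η hs'.1 hs'.2 hs.2 ht'.1 ht'.2 ht.2)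
    · intro a ha
      filter_upwards [prod_mem_prod (Ioc_mem_nhdsGT hγ) (Ioc_mem_nhdsGT hη)]
      rintro ⟨s', t'⟩ hst
      exact (le_csSup hbdd ⟨(s', t'), hst, rfl⟩).trans_lt ha

theorem Geodesic.ne_endpoint_iff {p : X} (γ : Geodesic p) : p ≠ γ.endpoint ↔ 0 < γ.len := by
  rw [← dist_pos, γ.dist_endpoint]

/-- In a `CAT(0)` space the limit defining the Alexandrov angle exists. -/
theorem tendsto_comparisonAngle [CAT0Space X] {p : X} (γ η : Geodesic p) (hγ : 0 < γ.len)
    (hη : 0 < η.len) :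
    Tendsto (fun st : ℝ × ℝ => comparisonAngle p (γ.eval st.1) (η.eval st.2))
      (𝓝[>] 0 ×ˢ 𝓝[>] 0) (𝓝 (alexandrovAngle γ η)) := by
  obtain ⟨c, -, hc⟩ := exists_tendsto_cosComparison γ η hγ hη
  have h : Tendsto (fun st : ℝ × ℝ => comparisonAngle p (γ.eval st.1) (η.eval st.2))
      (𝓝[>] 0 ×ˢ 𝓝[>] 0) (𝓝 (Real.arccos c)) := by
    refine ((Real.continuous_arccos.tendsto c).comp hc).congr' ?_
    filter_upwards [prod_mem_prod (Ioc_mem_nhdsGT hγ) (Ioc_mem_nhdsGT hη)]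
    rintro ⟨s, t⟩ ⟨hs, ht⟩
    exact (comparisonAngle_eval γ η hs ht).symm
  rw [alexandrovAngle, if_pos ⟨γ.ne_endpoint_iff.2 hγ, η.ne_endpoint_iff.2 hη⟩]
  exact tendsto_nhds_limUnder ⟨_, h⟩

theorem tendsto_cosComparison [CAT0Space X] {p : X} (γ η : Geodesic p) (hγ : 0 < γ.len)
    (hη : 0 < η.len) :
    Tendsto (fun st : ℝ × ℝ => cosComparison γ η st.1 st.2)
      (𝓝[>] 0 ×ˢ 𝓝[>] 0) (𝓝 (Real.cos (alexandrovAngle γ η))) := by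
  refine ((Real.continuous_cos.tendsto _).comp (tendsto_comparisonAngle γ η hγ hη)).congr' ?_
  filter_upwards [prod_mem_prod (Ioc_mem_nhdsGT hγ) (Ioc_mem_nhdsGT hη)]
  rintro ⟨s, t⟩ ⟨hs, ht⟩
  simp only [Function.comp_apply]
  rw [comparisonAngle_eval γ η hs ht, Real.cos_arccos (neg_one_le_cosComparison γ η hs ht)
    (cosComparison_le_one γ η hs ht)]

theorem PreTangent.length_nonneg {p : X} (a : PreTangent p) : 0 ≤ a.length :=
  mul_nonneg a.coeff.2 a.geodesic.len_nonneg

theorem PreTangent.eventually_mem {p : X} (a : PreTangent p) :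
    ∀ᶠ ε : ℝ in 𝓝[>] 0, ε * a.length ∈ Icc 0 a.geodesic.len := by
  have h : Tendsto (fun ε : ℝ => ε * a.coeff) (𝓝[>] 0) (𝓝 0) := by
    have : Tendsto (fun ε : ℝ => ε * a.coeff) (𝓝 0) (𝓝 (0 * a.coeff)) :=
      (continuous_id.mul continuous_const).tendsto 0
    rw [zero_mul] at this
    exact this.mono_left nhdsWithin_le_nhds
  filter_upwards [h.eventually (gt_mem_nhds one_pos), self_mem_nhdsWithin] with ε h1 h2
  have h2 : 0 < ε := h2
  refine ⟨mul_nonneg h2.le a.length_nonneg, ?_⟩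
  rw [PreTangent.length, ← mul_assoc]
  exact mul_le_of_le_one_left a.geodesic.len_nonneg h1.le

/-- The pseudometric on `Y` is the limit of rescaled distances in `X`. -/
theorem tendsto_preDist [CAT0Space X] {p : X} (a b : PreTangent p) :
    Tendsto (fun ε : ℝ => dist (a.geodesic.eval (ε * a.length)) (b.geodesic.eval (ε * b.length)) / ε)
      (𝓝[>] 0) (𝓝 (preDist a b)) := by
  rcases a.length_nonneg.eq_or_lt with ha | ha
  · have : preDist a b = b.length := by
      rw [preDist, ← ha]; simp [Real.sqrt_sq b.length_nonneg]
    rw [this]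
    refine tendsto_const_nhds.congr' ?_
    filter_upwards [b.eventually_mem, self_mem_nhdsWithin] with ε h1 h2
    rw [← ha, mul_zero, Geodesic.eval_zero, Geodesic.dist_start_eval _ h1,
      mul_div_cancel_left₀ _ (ne_of_gt h2)]
  rcases b.length_nonneg.eq_or_lt with hb | hb
  · have : preDist a b = a.length := by
      rw [preDist, ← hb]; simp [Real.sqrt_sq a.length_nonneg]
    rw [this]
    refine tendsto_const_nhds.congr' ?_
    filter_upwards [a.eventually_mem, self_mem_nhdsWithin] with ε h1 h2
    rw [← hb, mul_zero, Geodesic.eval_zero, dist_comm, Geodesic.dist_start_eval _ h1,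
      mul_div_cancel_left₀ _ (ne_of_gt h2)]
  have hγ : 0 < a.geodesic.len := lt_of_le_of_ne a.geodesic.len_nonneg fun h => by
    rw [PreTangent.length, ← h, mul_zero] at ha; exact ha.false
  have hη : 0 < b.geodesic.len := lt_of_le_of_ne b.geodesic.len_nonneg fun h => by
    rw [PreTangent.length, ← h, mul_zero] at hb; exact hb.false
  have hlin : ∀ c : ℝ, 0 < c → Tendsto (fun ε : ℝ => ε * c) (𝓝[>] 0) (𝓝[>] 0) := by
    intro c hc
    refine tendsto_nhdsWithin_iff.2 ⟨?_, ?_⟩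
    · have : Tendsto (fun ε : ℝ => ε * c) (𝓝 0) (𝓝 (0 * c)) :=
        (continuous_id.mul continuous_const).tendsto 0
      rw [zero_mul] at this
      exact this.mono_left nhdsWithin_le_nhds
    · filter_upwards [self_mem_nhdsWithin] with ε h
      exact mul_pos h hc
  have h := (tendsto_cosComparison a.geodesic b.geodesic hγ hη).comp
    ((hlin _ ha).prodMk (hlin _ hb))
  have h' := ((h.const_mul (2 * a.length * b.length)).const_sub
    (a.length ^ 2 + b.length ^ 2)).sqrt
  refine h'.congr' ?_
  filter_upwards [self_mem_nhdsWithin] with ε h2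
  have h2 : 0 < ε := h2
  have e : a.length ^ 2 + b.length ^ 2 - 2 * a.length * b.length *
      cosComparison a.geodesic b.geodesic (ε * a.length) (ε * b.length) =
      (dist (a.geodesic.eval (ε * a.length)) (b.geodesic.eval (ε * b.length)) / ε) ^ 2 := by
    rw [div_pow, cosComparison_mul _ _ (mul_pos h2 ha) (mul_pos h2 hb)]
    field_simp
  rw [← Real.sqrt_sq (div_nonneg dist_nonneg h2.le), ← e]
  rfl

/-- `Y = [0, ∞) × Γ_p` is a pseudometric space. -/
instance [CAT0Space X] (p : X) : PseudoMetricSpace (PreTangent p) where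
  dist := preDist
  dist_self a := by
    refine tendsto_nhds_unique (tendsto_preDist a a) ?_
    simp
  dist_comm a b := by
    refine tendsto_nhds_unique (tendsto_preDist a b) ?_
    simpa only [dist_comm] using tendsto_preDist b a
  dist_triangle a b c := by
    refine le_of_tendsto_of_tendsto (tendsto_preDist a c)
      ((tendsto_preDist a b).add (tendsto_preDist b c)) ?_
    filter_upwards [self_mem_nhdsWithin] with ε h
    have h : 0 < ε := h
    rw [← add_div]
    exact div_le_div_of_nonneg_right (dist_triangle _ _ _) h.le

/-! ### Tangent spaces and vector fields -/

/-- The tangent space `T_p X`: the metric quotient of `[0, ∞) × Γ_p`, in which pairs at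
distance zero are identified.  Its metric is the instance `MetricSpace (Tangent p)`. -/
abbrev Tangent [CAT0Space X] (p : X) : Type u := SeparationQuotient (PreTangent p)

/-- The class `α γ ∈ T_p X` of the pair `(α, γ)`. -/
def tangentMk [CAT0Space X] {p : X} (α : ℝ≥0) (γ : Geodesic p) : Tangent p :=
  SeparationQuotient.mk ⟨α, γ⟩

/-- The vertex `0_p = [(0, γ_{p,p})]` of `T_p X`. -/
def tangentZero [CAT0Space X] (p : X) : Tangent p := tangentMk 0 (geod p p)

/-- The function `g_p` on `T_p X × T_p X`. -/
def tangentInner [CAT0Space X] {p : X} (u v : Tangent p) : ℝ :=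
  (dist u (tangentZero p) ^ 2 + dist v (tangentZero p) ^ 2 - dist u v ^ 2) / 2

/-- A vector field: a set-valued map `A` on `X` with `A x ⊆ T_x X` for every `x`
(the value `A x` may be empty). -/
abbrev VectorField (X : Type u) [MetricSpace X] [CAT0Space X] : Type u :=
  (x : X) → Set (Tangent x)

/-- Monotone vector fields. -/
def VectorField.IsMonotone [CAT0Space X] (A : VectorField X) : Prop :=
  ∀ (x y : X), ∀ x' ∈ A x, ∀ y' ∈ A y,
    tangentInner x' (tangentMk 1 (geod x y)) + tangentInner y' (tangentMk 1 (geod y x)) ≤ 0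

/-- The resolvent `J_l x = {z | (1 / l) γ_{z,x} ∈ A z}` of `A` with respect to `l`. -/
def VectorField.resolvent [CAT0Space X] (A : VectorField X) (l : ℝ≥0) (x : X) : Set X :=
  {z | tangentMk (1 / l) (geod z x) ∈ A z}

/-- The surjectivity condition. -/
def VectorField.SurjectivityCondition [CAT0Space X] (A : VectorField X) : Prop :=
  ∀ l : ℝ≥0, 0 < l → ∀ x : X, ∃ z : X, tangentMk (1 / l) (geod z x) ∈ A z

/-- The set of zeros of `A`. -/
def VectorField.zer [CAT0Space X] (A : VectorField X) : Set X :=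
  {u | tangentZero u ∈ A u}

/-! ### Delta-convergence -/

/-- The asymptotic center of a sequence (upper limits are taken in `[0, ∞]`, so that the
definition makes sense for unbounded sequences). -/
def asymptoticCenter (x : ℕ → X) : Set X :=
  {z | ∀ y : X, limsup (fun n => edist z (x n)) atTop ≤ limsup (fun n => edist y (x n)) atTop}

/-- The sequence `x` is Delta-convergent to `p`: `p` is the unique asymptotic center of every
subsequence of `x`. -/
def DeltaConverges (x : ℕ → X) (p : X) : Prop :=
  ∀ φ : ℕ → ℕ, StrictMono φ → asymptoticCenter (x ∘ φ) = {p}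

end CAT0

end

/-!
The vector field enters only through a metric inequality. Alexandrov angles are at most comparison
angles, so `g_p(α γ_{p,x}, γ_{p,y})` is at least `α` times the inner product in a Euclidean comparison
triangle (`CAT0.le_tangentInner`). For `z = J_l x` and `w = J_m y`, monotonicity therefore gives
`(l + m) ρ(z,w)² + m ρ(z,x)² + l ρ(w,y)² ≤ m ρ(x,w)² + l ρ(y,z)²`
(`CAT0.VectorField.IsMonotone.resolvent_ineq`). In particular the iterates are Fejér monotone with
respect to the zeros, hence bounded as soon as a zero exists.

The other ingredient is the CN inequality: an upper limit of weighted averages of squared distances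
to a bounded sequence is uniformly convex, and so has a unique minimizer
(`CAT0.exists_unique_minimizer_limsup`).

* If the iterates are bounded and `∑ λ_n = ∞`, use averages with weights `λ_n`. The resolvent
  inequality telescopes and shows that `J_1` maps the minimizer `p` to a minimizer, so `J_1 p = p`
  is a zero.
* If a zero exists and `∑ λ_n² = ∞`, the quotients `ρ(x_n, x_{n+1}) / λ_n` are decreasing and
  square-summable with the weights `λ_n²`, hence tend to zero. The resolvent inequality then shows
  that `J_1` fixes the asymptotic center of every subsequence, so these centers are zeros. The
  distances from the iterates to a zero converge, so all these centers coincide.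
-/

open Set Filter Topology
open scoped NNReal ENNReal

namespace CAT0

universe u

/-! ### Distances in `CAT(0)` spaces -/

section Geometry

variable {X : Type u} [MetricSpace X]

theorem geod_len [UniquelyGeodesic X] (p q : X) : (geod p q).len = dist p q := by
  rw [← Geodesic.dist_endpoint, geod_endpoint]

theorem comb_one [UniquelyGeodesic X] (p q : X) : comb p q 1 = q := by
  rw [comb, one_mul, ← geod_len, Geodesic.eval_len, geod_endpoint]

/-- The Bruhat–Tits (CN) inequality: squared distance functions are uniformly convex at
midpoints. -/
theorem dist_comb_half_sq_le [CAT0Space X] (y z a : X) :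
    dist (comb y z (1 / 2)) a ^ 2 ≤
      dist y a ^ 2 / 2 + dist z a ^ 2 / 2 - dist y z ^ 2 / 4 := by
  obtain ⟨z', a', h1, h2, h3⟩ := exists_comparison_triangle y z a
  have h := CAT0Space.comparison y z a 0 z' a' h1 h2 h3 (1 / 2) ⟨by norm_num, by norm_num⟩
    1 ⟨zero_le_one, le_rfl⟩
  rw [comb_one] at h
  simp only [smul_zero, zero_add, one_smul] at h
  have hsq := pow_le_pow_left₀ dist_nonneg h 2
  rw [dist_zero_left] at h1
  rw [dist_comm, dist_zero_right] at h3
  rw [dist_eq_norm, norm_sub_sq_real, norm_smul, inner_smul_left] at hsq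
  rw [h1, h3, h2, dist_eq_norm, norm_sub_sq_real]
  norm_num at hsq ⊢
  linarith

/-- Alexandrov angles are at most comparison angles. -/
theorem cosComparison_le_cos_alexandrovAngle [CAT0Space X] {p : X} (γ η : Geodesic p)
    (hγ : 0 < γ.len) (hη : 0 < η.len) :
    cosComparison γ η γ.len η.len ≤ Real.cos (alexandrovAngle γ η) := by
  refine ge_of_tendsto (tendsto_cosComparison γ η hγ hη) ?_
  filter_upwards [prod_mem_prod (Ioc_mem_nhdsGT hγ) (Ioc_mem_nhdsGT hη)]
  rintro ⟨s, t⟩ ⟨hs, ht⟩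
  exact cosComparison_anti γ η hs.1 hs.2 le_rfl ht.1 ht.2 le_rfl

theorem preDist_sq {p : X} (a b : PreTangent p) :
    preDist a b ^ 2 = a.length ^ 2 + b.length ^ 2 -
      2 * a.length * b.length * Real.cos (alexandrovAngle a.geodesic b.geodesic) := by
  refine Real.sq_sqrt ?_
  have h1 := mul_nonneg a.length_nonneg b.length_nonneg
  have h2 := mul_le_mul_of_nonneg_left
    (Real.cos_le_one (alexandrovAngle a.geodesic b.geodesic)) h1
  nlinarith [sq_nonneg (a.length - b.length)]

end Geometry

/-! ### The form `g_p` on tangent spaces -/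

section Tangent

variable {X : Type u} [MetricSpace X] [CAT0Space X]

theorem dist_tangentMk {p : X} (α β : ℝ≥0) (γ η : Geodesic p) :
    dist (tangentMk α γ) (tangentMk β η) =
      preDist (⟨α, γ⟩ : PreTangent p) ⟨β, η⟩ := rfl

theorem tangentInner_tangentMk {p : X} (α β : ℝ≥0) (γ η : Geodesic p) :
    tangentInner (tangentMk α γ) (tangentMk β η) =
      α * γ.len * (β * η.len) * Real.cos (alexandrovAngle γ η) := by
  rw [tangentInner, tangentZero, dist_tangentMk, dist_tangentMk, dist_tangentMk,
    preDist_sq, preDist_sq, preDist_sq]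
  simp only [PreTangent.length, NNReal.coe_zero]
  ring

theorem tangentInner_tangentZero_left {p : X} (v : Tangent p) :
    tangentInner (tangentZero p) v = 0 := by
  rw [tangentInner, dist_self, dist_comm v]; ring

/-- The tangent vectors `α γ_{p,x}` and `γ_{p,y}` have at least the inner product that they have
in a Euclidean comparison triangle. -/
theorem le_tangentInner (α : ℝ≥0) (p x y : X) :
    α * ((dist p x ^ 2 + dist p y ^ 2 - dist x y ^ 2) / 2) ≤
      tangentInner (tangentMk α (geod p x)) (tangentMk 1 (geod p y)) := by
  rw [tangentInner_tangentMk, NNReal.coe_one, one_mul, mul_assoc, mul_assoc]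
  refine mul_le_mul_of_nonneg_left ?_ α.2
  rcases eq_or_ne p x with rfl | hx
  · rw [geod_len, dist_self]; simp
  rcases eq_or_ne p y with rfl | hy
  · rw [geod_len, geod_len, dist_self, dist_comm x]; simp
  have hx' : 0 < (geod p x).len := by rwa [geod_len, dist_pos]
  have hy' : 0 < (geod p y).len := by rwa [geod_len, dist_pos]
  have h := cosComparison_le_cos_alexandrovAngle _ _ hx' hy'
  have e := cosComparison_mul (geod p x) (geod p y) hx' hy'
  rw [Geodesic.eval_len, Geodesic.eval_len, geod_endpoint, geod_endpoint] at e
  have h' := mul_le_mul_of_nonneg_left h (mul_pos hx' hy').le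
  rw [e, ← geod_len, ← geod_len]
  linarith

theorem tangentMk_geod_self (α : ℝ≥0) (p : X) : tangentMk α (geod p p) = tangentZero p := by
  rw [← dist_eq_zero, tangentZero, dist_tangentMk]
  simp [preDist, PreTangent.length, geod_len]

end Tangent

/-! ### Resolvents of monotone vector fields -/

namespace VectorField

variable {X : Type u} [MetricSpace X] [CAT0Space X] {A : VectorField X}

theorem mem_zer_of_mem_resolvent_self {l : ℝ≥0} {z : X} (h : z ∈ A.resolvent l z) :
    z ∈ A.zer := by
  have h' : tangentMk (1 / l) (geod z z) ∈ A z := h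
  rwa [tangentMk_geod_self] at h'

/-- The metric form of monotonicity, in which `z = J_l x` and `w = J_m y`. -/
theorem IsMonotone.resolvent_ineq (hA : A.IsMonotone) {l m : ℝ≥0} (hl : 0 < l) (hm : 0 < m)
    {x y z w : X} (hz : z ∈ A.resolvent l x) (hw : w ∈ A.resolvent m y) :
    (l + m) * dist z w ^ 2 + m * dist z x ^ 2 + l * dist w y ^ 2 ≤
      m * dist x w ^ 2 + l * dist y z ^ 2 := by
  have h := hA z w _ hz _ hw
  have h1 := le_tangentInner (1 / l) z x w
  have h2 := le_tangentInner (1 / m) w y z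
  have hl' : (0 : ℝ) < l := hl
  have hm' : (0 : ℝ) < m := hm
  have h3 := mul_le_mul_of_nonneg_left (h1.trans (le_sub_iff_add_le.2
    ((add_le_add_right h2 _).trans h))) (mul_pos hl' hm').le
  push_cast at h3
  rw [dist_comm w z] at h3
  field_simp at h3
  linarith

/-- Resolvents contract quasi-firmly towards the zeros of the field. -/
theorem IsMonotone.dist_sq_add_dist_sq_le (hA : A.IsMonotone) {l : ℝ≥0} (hl : 0 < l)
    {x z u : X} (hz : z ∈ A.resolvent l x) (hu : u ∈ A.zer) :
    dist z x ^ 2 + dist z u ^ 2 ≤ dist x u ^ 2 := by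
  have hu' : u ∈ A.resolvent l u := by
    change tangentMk (1 / l) (geod u u) ∈ A u
    rwa [tangentMk_geod_self]
  have h := hA.resolvent_ineq hl hl hz hu'
  rw [dist_self, dist_comm u z] at h
  have hl' : (0 : ℝ) < l := hl
  refine le_of_mul_le_mul_left ?_ hl'
  linarith

end VectorField

/-! ### Minimizers of upper limits of weighted squared distances -/

/-- A perturbation that tends to zero does not increase upper limits of real sequences. -/
theorem limsup_le_limsup_of_le_add {a b e : ℕ → ℝ} (hab : ∀ᶠ n in atTop, a n ≤ b n + e n)
    (he : Tendsto e atTop (𝓝 0)) (ha : ∀ n, 0 ≤ a n) (hb : ∀ n, 0 ≤ b n)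
    (hb' : BddAbove (range b)) : limsup a atTop ≤ limsup b atTop := by
  have hb1 : IsBoundedUnder (· ≤ ·) atTop b := hb'.isBoundedUnder_of_range
  have hb2 : IsBoundedUnder (· ≥ ·) atTop b := isBoundedUnder_of ⟨0, hb⟩
  have ha2 : IsBoundedUnder (· ≥ ·) atTop a := isBoundedUnder_of ⟨0, ha⟩
  calc limsup a atTop ≤ limsup (b + e) atTop :=
        limsup_le_limsup hab ha2.isCoboundedUnder_le
          (isBoundedUnder_le_add hb1 he.isBoundedUnder_le)
    _ ≤ limsup b atTop + limsup e atTop :=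
        limsup_add_le hb2 hb1 he.isBoundedUnder_ge.isCoboundedUnder_le he.isBoundedUnder_le
    _ = limsup b atTop := by rw [he.limsup_eq, add_zero]

section Minimizer

variable {X : Type u} [MetricSpace X] [CompleteSpace X] [CAT0Space X]

/-- On an Hadamard space a nonnegative function that is uniformly convex at midpoints and lower
semicontinuous has a minimizer. -/
theorem exists_forall_le_of_midpoint_convex [Nonempty X] {f : X → ℝ} (hf0 : ∀ y, 0 ≤ f y)
    (hconv : ∀ y z, f (comb y z (1 / 2)) ≤ f y / 2 + f z / 2 - dist y z ^ 2 / 4)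
    (hlsc : LowerSemicontinuous f) : ∃ p, ∀ y, f p ≤ f y := by
  have hbdd : BddBelow (range f) := ⟨0, by rintro _ ⟨y, rfl⟩; exact hf0 y⟩
  set I := ⨅ y, f y with hI
  have hle : ∀ y, I ≤ f y := fun y => ciInf_le hbdd y
  have hd : ∀ y z, dist y z ^ 2 ≤ 2 * (f y - I) + 2 * (f z - I) := by
    intro y z
    have h1 := hconv y z
    have h2 := hle (comb y z (1 / 2))
    linarith
  have hex : ∀ n : ℕ, ∃ y, f y < I + 1 / ((n : ℝ) + 1) := fun n =>
    exists_lt_of_ciInf_lt (lt_add_of_pos_right _ (by positivity))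
  choose q hq using hex
  have hsmall : Tendsto (fun n : ℕ => 1 / ((n : ℝ) + 1)) atTop (𝓝 0) :=
    tendsto_one_div_add_atTop_nhds_zero_nat
  have hcauchy : CauchySeq q := by
    refine cauchySeq_of_le_tendsto_0 (fun n : ℕ => Real.sqrt (4 * (1 / ((n : ℝ) + 1)))) ?_ ?_
    · intro n m N hn hm
      refine Real.le_sqrt_of_sq_le ((hd _ _).trans ?_)
      have hn' := Nat.one_div_le_one_div (α := ℝ) hn
      have hm' := Nat.one_div_le_one_div (α := ℝ) hm
      linarith [hq n, hq m]
    · simpa using (hsmall.const_mul 4).sqrt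
  obtain ⟨p, hp⟩ := cauchySeq_tendsto_of_complete hcauchy
  refine ⟨p, fun y => le_trans ?_ (hle y)⟩
  have hlim : Tendsto (fun n : ℕ => I + 1 / ((n : ℝ) + 1)) atTop (𝓝 I) := by
    simpa using hsmall.const_add I
  by_contra! hlt
  obtain ⟨c, hc1, hc2⟩ := exists_between hlt
  obtain ⟨n, hn1, hn2⟩ :=
    ((hp.eventually (hlsc p c hc2)).and (hlim.eventually (gt_mem_nhds hc1))).exists
  exact absurd (hq n) (by linarith)

/-- Upper limits of weighted averages of the squared distances to a bounded sequence have a unique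
minimizer; uniqueness is stated as strictness of the minimum. -/
theorem exists_unique_minimizer_limsup {a : ℕ → X} (ha : Bornology.IsBounded (range a))
    (s : ℕ → Finset ℕ) (w : ℕ → ℕ → ℝ) (hw : ∀ n, ∀ k ∈ s n, 0 ≤ w n k)
    (hw1 : ∀ n, ∑ k ∈ s n, w n k = 1) :
    ∃ p, (∀ y, limsup (fun n => ∑ k ∈ s n, w n k * dist p (a k) ^ 2) atTop ≤
        limsup (fun n => ∑ k ∈ s n, w n k * dist y (a k) ^ 2) atTop) ∧
      ∀ q, limsup (fun n => ∑ k ∈ s n, w n k * dist q (a k) ^ 2) atTop ≤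
        limsup (fun n => ∑ k ∈ s n, w n k * dist p (a k) ^ 2) atTop → q = p := by
  set F : ℕ → X → ℝ := fun n y => ∑ k ∈ s n, w n k * dist y (a k) ^ 2 with hF
  -- Averaging a pointwise inequality; the constant `c` is unchanged as the weights sum to `1`.
  have havg : ∀ n (f g : ℕ → ℝ) (c : ℝ), (∀ k, f k ≤ g k + c) →
      ∑ k ∈ s n, w n k * f k ≤ ∑ k ∈ s n, w n k * g k + c := by
    intro n f g c h
    calc ∑ k ∈ s n, w n k * f k ≤ ∑ k ∈ s n, (w n k * g k + w n k * c) :=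
          Finset.sum_le_sum fun k hk => by
            rw [← mul_add]; exact mul_le_mul_of_nonneg_left (h k) (hw n k hk)
      _ = _ := by rw [Finset.sum_add_distrib, ← Finset.sum_mul, hw1, one_mul]
  have hF0 : ∀ n y, 0 ≤ F n y := fun n y =>
    Finset.sum_nonneg fun k hk => mul_nonneg (hw n k hk) (sq_nonneg _)
  have hR : ∀ y, ∃ R, 0 ≤ R ∧ ∀ k, dist y (a k) ≤ R := by
    intro y
    obtain ⟨R, hR⟩ := ha.subset_closedBall y
    have hR' : ∀ k, dist y (a k) ≤ R := fun k => by
      rw [dist_comm]; exact hR (mem_range_self k)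
    exact ⟨R, dist_nonneg.trans (hR' 0), hR'⟩
  have hFb : ∀ y, BddAbove (range fun n => F n y) := by
    intro y
    obtain ⟨R, -, hR⟩ := hR y
    refine ⟨R ^ 2, ?_⟩
    rintro _ ⟨n, rfl⟩
    have := havg n (fun k => dist y (a k) ^ 2) (fun _ => 0) (R ^ 2) fun k => by
      simpa using pow_le_pow_left₀ dist_nonneg (hR k) 2
    simpa using this
  have hB1 : ∀ y, IsBoundedUnder (· ≤ ·) atTop fun n => F n y :=
    fun y => (hFb y).isBoundedUnder_of_range
  have hB2 : ∀ y, IsBoundedUnder (· ≥ ·) atTop fun n => F n y :=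
    fun y => isBoundedUnder_of ⟨0, fun n => hF0 n y⟩
  set f : X → ℝ := fun y => limsup (fun n => F n y) atTop with hf
  have hf0 : ∀ y, 0 ≤ f y := fun y =>
    le_limsup_of_frequently_le (Frequently.of_forall fun n => hF0 n y) (hB1 y)
  have hadd : ∀ y c, limsup (fun n => F n y + c) atTop = f y + c := fun y c =>
    limsup_add_const atTop _ c (hB1 y) (hB2 y).isCoboundedUnder_le
  have hconv : ∀ y z, f (comb y z (1 / 2)) ≤ f y / 2 + f z / 2 - dist y z ^ 2 / 4 := by
    intro y z
    refine le_of_forall_pos_le_add fun ε hε => ?_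
    have hy := eventually_lt_of_limsup_lt (lt_add_of_pos_right (f y) hε) (hB1 y)
    have hz := eventually_lt_of_limsup_lt (lt_add_of_pos_right (f z) hε) (hB1 z)
    have hF' : ∀ n, F n (comb y z (1 / 2)) ≤ F n y / 2 + F n z / 2 - dist y z ^ 2 / 4 := by
      intro n
      have h := havg n (fun k => dist (comb y z (1 / 2)) (a k) ^ 2)
        (fun k => dist y (a k) ^ 2 / 2 + dist z (a k) ^ 2 / 2) (-(dist y z ^ 2 / 4)) fun k => by
          rw [← sub_eq_add_neg]; exact dist_comb_half_sq_le y z (a k)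
      simp only [mul_add, ← mul_div_assoc, Finset.sum_add_distrib, ← Finset.sum_div] at h
      exact h
    refine limsup_le_of_le (hB2 _).isCoboundedUnder_le ?_
    filter_upwards [hy, hz] with n hyn hzn
    have := hF' n
    linarith
  have hlsc : LowerSemicontinuous f := by
    intro y c hc
    obtain ⟨R, hR0, hR⟩ := hR y
    have hcont : ContinuousAt (fun z => f y - dist y z * (2 * R + dist y z)) y := by fun_prop
    have hev := hcont.eventually (lt_mem_nhds (a := c) (by simpa using hc))
    filter_upwards [hev] with z hz
    refine hz.trans_le ?_
    rw [sub_le_iff_le_add, ← hadd]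
    refine limsup_le_limsup (Eventually.of_forall fun n => ?_) (hB2 y).isCoboundedUnder_le
      (isBoundedUnder_le_add (hB1 z) isBoundedUnder_const)
    refine havg n _ _ _ fun k => ?_
    have h1 := dist_triangle y z (a k)
    have h2 := dist_triangle_left z (a k) y
    have h3 := hR k
    nlinarith [dist_nonneg (x := y) (y := z), dist_nonneg (x := z) (y := a k),
      dist_nonneg (x := y) (y := a k)]
  have : Nonempty X := ⟨a 0⟩
  obtain ⟨p, hp⟩ := exists_forall_le_of_midpoint_convex hf0 hconv hlsc
  refine ⟨p, hp, fun q hq => ?_⟩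
  have h1 := hconv q p
  have h2 := hp (comb q p (1 / 2))
  have hq' : f q ≤ f p := hq
  have h3 : dist q p ^ 2 ≤ 0 := by linarith
  exact dist_eq_zero.1 (pow_eq_zero_iff two_ne_zero |>.1 (h3.antisymm (sq_nonneg _)))

end Minimizer

/-! ### Asymptotic centers -/

section AsymptoticCenter

variable {X : Type u} [MetricSpace X]

theorem limsup_edist_le_iff {a : ℕ → X} (ha : Bornology.IsBounded (range a)) (y z : X) :
    limsup (fun n => edist z (a n)) atTop ≤ limsup (fun n => edist y (a n)) atTop ↔
      limsup (fun n => dist z (a n) ^ 2) atTop ≤ limsup (fun n => dist y (a n) ^ 2) atTop := by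
  have hb : ∀ y, IsBoundedUnder (· ≤ ·) atTop fun n => dist y (a n) ^ 2 := by
    intro y
    obtain ⟨R, hR⟩ := ha.subset_closedBall y
    refine isBoundedUnder_of ⟨R ^ 2, fun n => pow_le_pow_left₀ dist_nonneg ?_ 2⟩
    rw [dist_comm]; exact hR (mem_range_self n)
  have hb' : ∀ y, IsBoundedUnder (· ≥ ·) atTop fun n => dist y (a n) ^ 2 :=
    fun y => isBoundedUnder_of ⟨0, fun n => sq_nonneg _⟩
  have h0 : 0 ≤ limsup (fun n => dist y (a n) ^ 2) atTop :=
    le_limsup_of_frequently_le (Frequently.of_forall fun n => sq_nonneg _) (hb y)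
  have hg : Monotone fun r : ℝ => ENNReal.ofReal (Real.sqrt r) := fun r s h =>
    ENNReal.ofReal_le_ofReal (Real.sqrt_le_sqrt h)
  have key : ∀ y, limsup (fun n => edist y (a n)) atTop =
      ENNReal.ofReal (Real.sqrt (limsup (fun n => dist y (a n) ^ 2) atTop)) := by
    intro y
    rw [hg.map_limsup_of_continuousAt (fun n => dist y (a n) ^ 2)
      (ENNReal.continuous_ofReal.comp Real.continuous_sqrt).continuousAt (hb y)
      (hb' y).isCoboundedUnder_le]
    congr 1
    ext n
    simp [Real.sqrt_sq dist_nonneg, edist_dist]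
  rw [key, key, ENNReal.ofReal_le_ofReal_iff (Real.sqrt_nonneg _), Real.sqrt_le_sqrt_iff h0]

theorem mem_asymptoticCenter_iff {a : ℕ → X} (ha : Bornology.IsBounded (range a)) {z : X} :
    z ∈ asymptoticCenter a ↔ ∀ y,
      limsup (fun n => dist z (a n) ^ 2) atTop ≤ limsup (fun n => dist y (a n) ^ 2) atTop :=
  forall_congr' fun y => limsup_edist_le_iff ha y z

/-- In an Hadamard space a bounded sequence has exactly one asymptotic center. -/
theorem exists_asymptoticCenter_eq_singleton [CompleteSpace X] [CAT0Space X] {a : ℕ → X}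
    (ha : Bornology.IsBounded (range a)) : ∃ p, asymptoticCenter a = {p} := by
  obtain ⟨p, h1, h2⟩ := exists_unique_minimizer_limsup ha (fun n => {n}) (fun _ _ => 1)
    (fun _ _ _ => zero_le_one) (fun n => by simp)
  simp only [Finset.sum_singleton, one_mul] at h1 h2
  refine ⟨p, Subset.antisymm (fun q hq => ?_) ?_⟩
  · exact h2 q ((mem_asymptoticCenter_iff ha).1 hq p)
  · rintro _ rfl
    exact (mem_asymptoticCenter_iff ha).2 h1

end AsymptoticCenter

/-! ### The proximal point algorithm -/

section ProximalPoint

variable {X : Type u} [MetricSpace X] [CAT0Space X] {A : VectorField X}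
  {lam : ℕ → ℝ≥0} {x : ℕ → X}

theorem antitone_dist_of_mem_zer (hA : A.IsMonotone) (hlam : ∀ n, 0 < lam n)
    (hx : ∀ n, x (n + 1) ∈ A.resolvent (lam n) (x n)) {u : X} (hu : u ∈ A.zer) :
    Antitone fun n => dist u (x n) := by
  refine antitone_nat_of_succ_le fun n => ?_
  have h := hA.dist_sq_add_dist_sq_le (hlam n) (hx n) hu
  rw [dist_comm u, dist_comm u]
  refine pow_le_pow_iff_left₀ dist_nonneg dist_nonneg two_ne_zero |>.1 ?_
  linarith [sq_nonneg (dist (x (n + 1)) (x n))]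

theorem isBounded_range_of_mem_zer (hA : A.IsMonotone) (hlam : ∀ n, 0 < lam n)
    (hx : ∀ n, x (n + 1) ∈ A.resolvent (lam n) (x n)) {u : X} (hu : u ∈ A.zer) :
    Bornology.IsBounded (range x) := by
  refine Metric.isBounded_closedBall (x := u) (r := dist u (x 0)) |>.subset ?_
  rintro _ ⟨n, rfl⟩
  rw [Metric.mem_closedBall, dist_comm]
  exact antitone_dist_of_mem_zer hA hlam hx hu (Nat.zero_le n)

/-- If the iterates are bounded and `∑ λ_n` diverges, the minimizer of the upper limit of the
`λ`-weighted averages of squared distances to the iterates is a zero. -/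
theorem zer_nonempty_of_isBounded [CompleteSpace X] (hA : A.IsMonotone)
    (hsurj : A.SurjectivityCondition) (hlam : ∀ n, 0 < lam n)
    (hx : ∀ n, x (n + 1) ∈ A.resolvent (lam n) (x n))
    (hsum : Tendsto (fun N => ∑ n ∈ Finset.range N, (lam n : ℝ)) atTop atTop)
    (hbdd : Bornology.IsBounded (range x)) : A.zer.Nonempty := by
  set S : ℕ → ℝ := fun N => ∑ n ∈ Finset.range (N + 1), (lam n : ℝ) with hS
  have hlam' : ∀ n, (0 : ℝ) < lam n := hlam
  have hSpos : ∀ N, 0 < S N := fun N =>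
    Finset.sum_pos (fun n _ => hlam' n) ⟨0, by simp⟩
  have hbdd' : Bornology.IsBounded (range fun n => x (n + 1)) :=
    hbdd.subset (by rintro _ ⟨n, rfl⟩; exact mem_range_self _)
  obtain ⟨p, -, hp⟩ := exists_unique_minimizer_limsup hbdd'
    (fun N => Finset.range (N + 1)) (fun N n => lam n / S N)
    (fun N n _ => (div_pos (hlam' n) (hSpos N)).le)
    (fun N => by rw [← Finset.sum_div, div_self (hSpos N).ne'])
  obtain ⟨w, hw⟩ := hsurj 1 one_pos p
  have hsum_eq : ∀ N y, ∑ n ∈ Finset.range (N + 1), lam n / S N * dist y (x (n + 1)) ^ 2 =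
      (∑ n ∈ Finset.range (N + 1), lam n * dist y (x (n + 1)) ^ 2) / S N := fun N y => by
    rw [Finset.sum_div]; exact Finset.sum_congr rfl fun n _ => by ring
  have hnn : ∀ y N, 0 ≤ ∑ n ∈ Finset.range (N + 1), lam n / S N * dist y (x (n + 1)) ^ 2 :=
    fun y N => Finset.sum_nonneg fun n _ =>
      mul_nonneg (div_pos (hlam' n) (hSpos N)).le (sq_nonneg _)
  -- The resolvent inequality for `x (n + 1)` and `w = J_1 p` telescopes.
  have htel : ∀ N, ∑ n ∈ Finset.range N, (lam n : ℝ) * dist w (x (n + 1)) ^ 2 +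
      dist w (x N) ^ 2 ≤
      ∑ n ∈ Finset.range N, (lam n : ℝ) * dist p (x (n + 1)) ^ 2 + dist w (x 0) ^ 2 := by
    intro N
    induction N with
    | zero => simp
    | succ N ih =>
      rw [Finset.sum_range_succ, Finset.sum_range_succ]
      have h := hA.resolvent_ineq (hlam N) one_pos (hx N) hw
      rw [dist_comm (x (N + 1)) w, dist_comm (x N) w, NNReal.coe_one] at h
      nlinarith [sq_nonneg (dist (x (N + 1)) (x N)),
        mul_nonneg (hlam' N).le (sq_nonneg (dist w p))]
  have hwp : w = p := by
    refine hp w (limsup_le_limsup_of_le_add (e := fun N => dist w (x 0) ^ 2 / S N)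
      (Eventually.of_forall fun N => ?_) ?_ (hnn w) (hnn p) ?_)
    · rw [hsum_eq, hsum_eq, ← add_div]
      refine div_le_div_of_nonneg_right ?_ (hSpos N).le
      linarith [htel (N + 1), sq_nonneg (dist w (x (N + 1)))]
    · exact tendsto_const_nhds.div_atTop (hsum.comp (tendsto_add_atTop_nat 1))
    · obtain ⟨R, hR⟩ := hbdd.subset_closedBall p
      refine ⟨R ^ 2, ?_⟩
      rintro _ ⟨N, rfl⟩
      simp only [hsum_eq]
      rw [div_le_iff₀ (hSpos N), hS, Finset.mul_sum]
      refine Finset.sum_le_sum fun n _ => ?_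
      rw [mul_comm]
      refine mul_le_mul_of_nonneg_right (pow_le_pow_left₀ dist_nonneg ?_ 2) (hlam' n).le
      rw [dist_comm]
      exact hR (mem_range_self _)
  subst hwp
  exact ⟨w, VectorField.mem_zer_of_mem_resolvent_self hw⟩

/-- The norms `ρ(x_n, x_{n+1}) / λ_n` of the selected vectors decrease to zero: their squares are
summable with the weights `λ_n ^ 2`. -/
theorem tendsto_dist_div_lam (hA : A.IsMonotone) (hlam : ∀ n, 0 < lam n)
    (hx : ∀ n, x (n + 1) ∈ A.resolvent (lam n) (x n))
    (hsum : Tendsto (fun N => ∑ n ∈ Finset.range N, (lam n : ℝ) ^ 2) atTop atTop)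
    (hzer : A.zer.Nonempty) :
    Tendsto (fun n => dist (x (n + 1)) (x n) / lam n) atTop (𝓝 0) := by
  obtain ⟨u, hu⟩ := hzer
  set r : ℕ → ℝ := fun n => dist (x (n + 1)) (x n) / lam n with hr
  have hlam' : ∀ n, (0 : ℝ) < lam n := hlam
  have hr0 : ∀ n, 0 ≤ r n := fun n => div_nonneg dist_nonneg (hlam' n).le
  have hanti : Antitone r := by
    refine antitone_nat_of_succ_le fun n => ?_
    have h := hA.resolvent_ineq (hlam n) (hlam (n + 1)) (hx n) (hx (n + 1))
    have ht := dist_triangle (x n) (x (n + 1)) (x (n + 2))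
    rw [dist_self, dist_comm (x (n + 1 + 1))] at h
    simp only [hr]
    rw [dist_comm (x (n + 1 + 1)), div_le_div_iff₀ (hlam' _) (hlam' _)]
    rw [dist_comm (x n) (x (n + 1))] at ht
    set a := dist (x (n + 1)) (x n)
    set b := dist (x (n + 1)) (x (n + 1 + 1))
    have hc := mul_le_mul_of_nonneg_left (pow_le_pow_left₀ dist_nonneg ht 2) (hlam' (n + 1)).le
    rcases (dist_nonneg : 0 ≤ b).eq_or_lt with hb | hb
    · refine (mul_eq_zero_of_left hb.symm _).trans_le ?_
      exact mul_nonneg dist_nonneg (hlam' _).le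
    · refine le_of_mul_le_mul_left ?_ hb
      linarith
  have hbdd : BddBelow (range r) := ⟨0, by rintro _ ⟨n, rfl⟩; exact hr0 n⟩
  have hlim := tendsto_atTop_ciInf hanti hbdd
  set L := ⨅ n, r n
  have hL0 : 0 ≤ L := le_ciInf hr0
  have hL : ∀ N, L ^ 2 * ∑ n ∈ Finset.range N, (lam n : ℝ) ^ 2 + dist (x N) u ^ 2 ≤
      dist (x 0) u ^ 2 := by
    intro N
    induction N with
    | zero => simp
    | succ N ih =>
      rw [Finset.sum_range_succ]
      have h := hA.dist_sq_add_dist_sq_le (hlam N) (hx N) hu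
      have h1 : L * lam N ≤ dist (x (N + 1)) (x N) :=
        (le_div_iff₀ (hlam' N)).1 (ciInf_le hbdd N)
      have h2 := pow_le_pow_left₀ (mul_nonneg hL0 (hlam' N).le) h1 2
      linarith
  rcases hL0.eq_or_lt with h | h
  · rwa [← h] at hlim
  · obtain ⟨N, hN⟩ := (hsum.eventually_gt_atTop (dist (x 0) u ^ 2 / L ^ 2)).exists
    rw [div_lt_iff₀ (by positivity)] at hN
    linarith [hL N, sq_nonneg (dist (x N) u)]

/-- An asymptotic center of a subsequence of the iterates is a zero: its image under the resolvent
`J_1` is also an asymptotic center. -/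
theorem mem_zer_of_asymptoticCenter_eq (hA : A.IsMonotone)
    (hsurj : A.SurjectivityCondition) (hlam : ∀ n, 0 < lam n)
    (hx : ∀ n, x (n + 1) ∈ A.resolvent (lam n) (x n)) (hbdd : Bornology.IsBounded (range x))
    (hr : Tendsto (fun n => dist (x (n + 1)) (x n) / lam n) atTop (𝓝 0))
    {φ : ℕ → ℕ} (hφ : StrictMono φ) {p : X} (hp : asymptoticCenter (x ∘ φ) = {p}) :
    p ∈ A.zer := by
  obtain ⟨w, hw⟩ := hsurj 1 one_pos p
  have hφb : Bornology.IsBounded (range (x ∘ φ)) := hbdd.subset (range_comp_subset_range φ x)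
  have hpc : p ∈ asymptoticCenter (x ∘ φ) := by rw [hp]; rfl
  have hB : ∀ y, ∃ R, ∀ n, dist y (x n) ≤ R := by
    intro y
    obtain ⟨R, hR⟩ := hbdd.subset_closedBall y
    exact ⟨R, fun n => by rw [dist_comm]; exact hR (mem_range_self n)⟩
  obtain ⟨M, hM⟩ := hB w
  have hkey : ∀ n, dist w (x (n + 1)) ^ 2 ≤
      dist p (x (n + 1)) ^ 2 + 2 * M * (dist (x (n + 1)) (x n) / lam n) := by
    intro n
    have hl : (0 : ℝ) < lam n := hlam n
    have h := hA.resolvent_ineq (hlam n) one_pos (hx n) hw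
    rw [dist_comm (x (n + 1)) w, dist_comm (x n) w, NNReal.coe_one] at h
    have ht := pow_le_pow_left₀ dist_nonneg (dist_triangle w (x (n + 1)) (x n)) 2
    have hm := mul_le_mul_of_nonneg_right (hM (n + 1))
      (dist_nonneg (x := x (n + 1)) (y := x n))
    refine le_of_mul_le_mul_left ?_ hl
    have e : (lam n : ℝ) * (dist p (x (n + 1)) ^ 2 +
        2 * M * (dist (x (n + 1)) (x n) / lam n)) =
        lam n * dist p (x (n + 1)) ^ 2 + 2 * M * dist (x (n + 1)) (x n) := by field_simp
    rw [e]
    linarith [mul_nonneg hl.le (sq_nonneg (dist w p))]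
  have hle : limsup (fun n => dist w ((x ∘ φ) n) ^ 2) atTop ≤
      limsup (fun n => dist p ((x ∘ φ) n) ^ 2) atTop := by
    have hφ' : Tendsto (fun n => φ n - 1) atTop atTop :=
      (tendsto_sub_atTop_nat 1).comp hφ.tendsto_atTop
    have he := (hr.comp hφ').const_mul (2 * M)
    rw [mul_zero] at he
    refine limsup_le_limsup_of_le_add ?_ he (fun _ => sq_nonneg _) (fun _ => sq_nonneg _) ?_
    · filter_upwards [hφ.tendsto_atTop.eventually_ge_atTop 1] with n hn
      have h := hkey (φ n - 1)
      rw [Nat.sub_add_cancel hn] at h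
      simpa only [Function.comp_apply, Nat.sub_add_cancel hn] using h
    · obtain ⟨R, hR⟩ := hB p
      refine ⟨R ^ 2, ?_⟩
      rintro _ ⟨n, rfl⟩
      exact pow_le_pow_left₀ dist_nonneg (hR _) 2
  have hwc : w ∈ asymptoticCenter (x ∘ φ) := (mem_asymptoticCenter_iff hφb).2 fun y =>
    hle.trans ((mem_asymptoticCenter_iff hφb).1 hpc y)
  rw [hp] at hwc
  obtain rfl : w = p := hwc
  exact VectorField.mem_zer_of_mem_resolvent_self hw

theorem exists_deltaConverges [CompleteSpace X] (hA : A.IsMonotone)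
    (hsurj : A.SurjectivityCondition) (hlam : ∀ n, 0 < lam n)
    (hx : ∀ n, x (n + 1) ∈ A.resolvent (lam n) (x n)) (hzer : A.zer.Nonempty)
    (hsum : Tendsto (fun N => ∑ n ∈ Finset.range N, (lam n : ℝ) ^ 2) atTop atTop) :
    ∃ p ∈ A.zer, DeltaConverges x p := by
  have hr := tendsto_dist_div_lam hA hlam hx hsum hzer
  obtain ⟨u, hu⟩ := hzer
  have hbdd := isBounded_range_of_mem_zer hA hlam hx hu
  -- Along every subsequence the squared distances to a zero have the same upper limit.
  have hlim : ∀ v ∈ A.zer, ∀ φ : ℕ → ℕ, StrictMono φ →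
      limsup (fun n => dist v ((x ∘ φ) n) ^ 2) atTop = limsup (fun n => dist v (x n) ^ 2) atTop := by
    intro v hv φ hφ
    have h := (tendsto_atTop_ciInf (antitone_dist_of_mem_zer hA hlam hx hv)
      ⟨0, by rintro _ ⟨n, rfl⟩; exact dist_nonneg⟩).pow 2
    rw [h.limsup_eq]
    exact (h.comp hφ.tendsto_atTop).limsup_eq
  obtain ⟨p, hp⟩ := exists_asymptoticCenter_eq_singleton hbdd
  have hpz : p ∈ A.zer :=
    mem_zer_of_asymptoticCenter_eq hA hsurj hlam hx hbdd hr strictMono_id hp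
  refine ⟨p, hpz, fun φ hφ => ?_⟩
  have hφb : Bornology.IsBounded (range (x ∘ φ)) := hbdd.subset (range_comp_subset_range φ x)
  obtain ⟨q, hq⟩ := exists_asymptoticCenter_eq_singleton hφb
  have hqz := mem_zer_of_asymptoticCenter_eq hA hsurj hlam hx hbdd hr hφ hq
  have hqc : q ∈ asymptoticCenter (x ∘ φ) := by rw [hq]; rfl
  have hpc : p ∈ asymptoticCenter x := by rw [hp]; rfl
  have hqp := (mem_asymptoticCenter_iff hφb).1 hqc p
  rw [hlim q hqz φ hφ, hlim p hpz φ hφ] at hqp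
  have hqx : q ∈ asymptoticCenter x := (mem_asymptoticCenter_iff hbdd).2 fun y =>
    hqp.trans ((mem_asymptoticCenter_iff hbdd).1 hpc y)
  rw [hp] at hqx
  obtain rfl : q = p := hqx
  exact hq

end ProximalPoint

end CAT0

theorem theorem5p1 {X : Type*} [MetricSpace X] [CompleteSpace X] [CAT0.CAT0Space X]
    (A : CAT0.VectorField X) (hmono : A.IsMonotone) (hsurj : A.SurjectivityCondition)
    (lam : ℕ → ℝ≥0) (hlam : ∀ n, 0 < lam n)
    (x : ℕ → X) (hx : ∀ n, x (n + 1) ∈ A.resolvent (lam n) (x n)) :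
    (Tendsto (fun N => ∑ n ∈ Finset.range N, (lam n : ℝ)) atTop atTop →
      (Bornology.IsBounded (Set.range x) ↔ A.zer.Nonempty)) ∧
    (A.zer.Nonempty →
      Tendsto (fun N => ∑ n ∈ Finset.range N, (lam n : ℝ) ^ 2) atTop atTop →
      ∃ p ∈ A.zer, CAT0.DeltaConverges x p) :=
  ⟨fun hsum => ⟨CAT0.zer_nonempty_of_isBounded hmono hsurj hlam hx hsum, fun ⟨_, hu⟩ =>
    CAT0.isBounded_range_of_mem_zer hmono hlam hx hu⟩,
    CAT0.exists_deltaConverges hmono hsurj hlam hx⟩
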